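/- Let $\mathcal L:\mathbb C^8\to\mathbb R^6$ be $-\tfrac12$ times the map with components $$|z_1|^2+|z_5|^2-6,\quad |z_2|^2+|z_5|^2+|z_7|^2-10,\quad |z_3|^2+|z_7|^2-6,$$ $$|z_4|^2-|z_5|^2+|z_7|^2-4,\quad |z_5|^2-|z_6|^2+|z_7|^2-2,\quad |z_5|^2-|z_7|^2+|z_8|^2-4,$$ and let $M=\mathcal L^{-1}(0)/\mathbb T^6$ be the quotient by the $\mathbb T^6$-action generated by $\mathcal L$ (the Hamiltonian flow of the $i$-th component multiplies $z_k$ by $e^{iA_{ik}\theta}$, where $A_{ik}$ is the coefficient of $|z_k|^2$ in the $i$-th expression above). Points of $M$ are written $[z_1,\dots,z_8]$. For $1\le\nu\le 8$ (indices mod $8$) let $U_\nu\subset M$ be the set of $[z]$ with $z_k\ne0$ for all $k\notin\{\nu,\nu+1\}$, and let $\varphi_\nu$, defined on an open subset of $\mathbb C^2$, be the chart of $U_\nu$ that sends $(w_1,w_2)$ to the class of the point of $\mathcal L^{-1}(0)$ with $z_\nu=w_1$, $z_{\nu+1}=w_2$ and all other coordinates real and strictly positive; these eight charts form the smooth atlas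 of the $4$-manifold $M$. Define on $M$ the functions $$J=\tfrac12|z_1|^2,\quad H=\tfrac12|z_3|^2,\quad \gamma_1=\tfrac1{50}\Re(\overline{z_2z_3z_4}\,z_6z_7z_8),$$ $$\gamma_2=\tfrac1{50}|z_5|^4|z_4|^4,\quad \gamma_3=\tfrac1{50}|z_4|^4|z_7|^4,\quad \gamma_4=\tfrac1{100}|z_5|^4|z_7|^4,$$ and, for $t=(t_1,\dots,t_4)\in\mathbb R^4$, $H_t=(1-2t_1)H+\sum_{j=1}^4t_j\gamma_j$. **Theorem.** For all $t\in\mathbb R^4$, the points $$\varphi_2(0,0)=[\sqrt2,0,0,\sqrt2,2,2\sqrt2,\sqrt6,\sqrt6],\qquad \varphi_3(0,0)=[2,\sqrt2,0,0,\sqrt2,\sqrt6,\sqrt6,2\sqrt2],$$ $$\varphi_6(0,0)=[2,2\sqrt2,\sqrt6,\sqrt6,\sqrt2,0,0,\sqrt2],\qquad \varphi_7(0,0)=[\sqrt2,\sqrt6,\sqrt6,2\sqrt2,2,\sqrt2,0,0]$$ are singular points of rank zero of $(J,H_t):M\to\mathbb R^2$, i.e. the differential $d(J,H_t)$ exists and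 vanishes (has rank $0$) there. Moreover $J(\varphi_2(0,0))=J(\varphi_7(0,0))=1$ and $J(\varphi_3(0,0))=J(\varphi_6(0,0))=2$. -/

import Mathlib

namespace Octagon

open scoped Manifold ContDiff

/-- The torus `𝕋⁶`. Throughout, indices are zero-based: the index `k : Fin 8` stands for the
coordinate `z_{k+1}` on `ℂ⁸`, and `i : Fin 6` for the `(i+1)`-st manifold equation. -/
abbrev Torus6 : Type := Fin 6 → Circle

/-- Coefficients of `|z_1|², …, |z_8|²` in the six manifold equations. -/
def weight : Matrix (Fin 6) (Fin 8) ℤ :=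
  !![1, 0, 0, 0,  1,  0,  0, 0;
     0, 1, 0, 0,  1,  0,  1, 0;
     0, 0, 1, 0,  0,  0,  1, 0;
     0, 0, 0, 1, -1,  0,  1, 0;
     0, 0, 0, 0,  1, -1,  1, 0;
     0, 0, 0, 0,  1,  0, -1, 1]

/-- Constants of the six manifold equations. -/
def level : Fin 6 → ℤ := ![6, 10, 6, 4, 2, 4]

/-- The map `𝓛 : ℂ⁸ → ℝ⁶`, with components `-1/2` times
`|z_1|² + |z_5|² - 6`, `|z_2|² + |z_5|² + |z_7|² - 10`, `|z_3|² + |z_7|² - 6`,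
`|z_4|² - |z_5|² + |z_7|² - 4`, `|z_5|² - |z_6|² + |z_7|² - 2`, `|z_5|² - |z_7|² + |z_8|² - 4`. -/
noncomputable def momentum (z : Fin 8 → ℂ) (i : Fin 6) : ℝ :=
  -(1 / 2) * (∑ k, (weight i k : ℝ) * ‖z k‖ ^ 2 - level i)

/-- The level set `𝓛⁻¹(0) ⊆ ℂ⁸`. -/
def ZeroLevel : Type := {z : Fin 8 → ℂ // momentum z = 0}

instance : TopologicalSpace ZeroLevel := inferInstanceAs (TopologicalSpace {z : Fin 8 → ℂ // _})

/-- The factor by which `t ∈ 𝕋⁶` acts on the coordinate `k`. For `t = (e^{iθ_1}, …, e^{iθ_6})` it is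
`exp (i ∑ θ_i A_{ik})` with `A` the weight matrix: the Hamiltonian flow of the `i`-th component of
`𝓛` is `z_k ↦ e^{i A_{ik} θ} z_k`. -/
noncomputable def character (t : Torus6) (k : Fin 8) : Circle := ∏ i, t i ^ weight i k

lemma character_one (k : Fin 8) : character 1 k = 1 := by simp [character]

lemma character_mul (s t : Torus6) (k : Fin 8) :
    character (s * t) k = character s k * character t k := by
  simp [character, mul_zpow, Finset.prod_mul_distrib]

/-- The `𝕋⁶`-action generated by `𝓛` on its zero level. -/
noncomputable instance : MulAction Torus6 ZeroLevel where
  smul t z := ⟨fun k => (character t k : ℂ) * z.1 k, by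
    refine Eq.trans ?_ z.2; funext i; simp only [momentum, norm_mul, Circle.norm_coe, one_mul]⟩
  one_smul z := by
    apply Subtype.ext; funext k
    change (character 1 k : ℂ) * z.1 k = z.1 k
    simp [character_one]
  mul_smul s t z := by
    apply Subtype.ext; funext k
    change (character (s * t) k : ℂ) * z.1 k = character s k * (character t k * z.1 k)
    simp [character_mul, mul_assoc]

lemma smul_apply (t : Torus6) (z : ZeroLevel) (k : Fin 8) :
    (t • z).1 k = character t k * z.1 k := rfl

/-- The symplectic quotient `M = 𝓛⁻¹(0) / 𝕋⁶`, with the quotient topology. -/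
def M : Type := Quotient (MulAction.orbitRel Torus6 ZeroLevel)

noncomputable instance : TopologicalSpace M :=
  inferInstanceAs (TopologicalSpace (Quotient (MulAction.orbitRel Torus6 ZeroLevel)))

/-- The class `[z_1, …, z_8] ∈ M` of a point of `𝓛⁻¹(0)`. -/
noncomputable def mk (z : Fin 8 → ℂ) (hz : momentum z = 0) : M := Quotient.mk _ ⟨z, hz⟩

/-- The function on `M` induced by a `𝕋⁶`-invariant function on `ℂ⁸`. -/
noncomputable def lift {β : Type*} (f : (Fin 8 → ℂ) → β)
    (hf : ∀ (t : Torus6) (z : Fin 8 → ℂ), f (fun k => (character t k : ℂ) * z k) = f z) :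
    M → β :=
  Quotient.lift (fun z : ZeroLevel => f z.1) (by
    rintro a b ⟨t, rfl⟩
    exact hf t b.1)

/-- Inward normals of the edges of the octagon: on `𝓛⁻¹(0)` one has
`|z_k|² = (normal k).1 * |z_1|² + (normal k).2 * |z_3|² + offset k`. -/
def normal : Fin 8 → ℤ × ℤ :=
  ![(1, 0), (1, 1), (0, 1), (-1, 1), (-1, 0), (-1, -1), (0, -1), (1, -1)]

def offset : Fin 8 → ℤ := ![0, -2, 0, 4, 6, 10, 6, 4]

def det (k l : Fin 8) : ℤ := (normal k).1 * (normal l).2 - (normal k).2 * (normal l).1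

/-- The value of `|z_k|²` on `𝓛⁻¹(0)` in terms of `z_ν = w.1`, `z_{ν+1} = w.2` (indices mod 8), as
determined by the manifold equations. With `a = |w.1|²`, `b = |w.2|²` it reads, in the first chart,
`(a, b, 2-a+b, 6-2a+b, 6-a, 8-b, 4+a-b, 2+2a-b)` and, in the second one,
`(2+a-b, a, b, 2-a+2b, 4-a+b, 8-a, 6-b, 6+a-2b)`. -/
noncomputable def chartSq (ν : Fin 8) (w : ℂ × ℂ) (k : Fin 8) : ℝ :=
  det k (ν + 1) * (‖w.1‖ ^ 2 - offset ν) + det ν k * (‖w.2‖ ^ 2 - offset (ν + 1)) + offset k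

lemma det_succ (ν : Fin 8) : det ν (ν + 1) = 1 := by revert ν; decide
lemma det_self (ν : Fin 8) : det ν ν = 0 := by revert ν; decide
lemma weight_det (i : Fin 6) (l : Fin 8) : ∑ k, weight i k * det k l = 0 := by
  revert i l; decide
lemma weight_det' (i : Fin 6) (l : Fin 8) : ∑ k, weight i k * det l k = 0 := by
  revert i l; decide
lemma weight_offset (i : Fin 6) : ∑ k, weight i k * offset k = level i := by
  revert i; decide
lemma det_rel (ν k l : Fin 8) : det k l = det k (ν + 1) * det ν l + det ν k * det (ν + 1) l := by
  revert ν k l; decide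

lemma momentum_eq_zero_of_sq (ν : Fin 8) (w : ℂ × ℂ) (z : Fin 8 → ℂ)
    (h : ∀ k, ‖z k‖ ^ 2 = chartSq ν w k) : momentum z = 0 := by
  funext i
  have h1 : (∑ k, (weight i k : ℝ) * det k (ν + 1)) = 0 := by exact_mod_cast weight_det i (ν + 1)
  have h2 : (∑ k, (weight i k : ℝ) * det ν k) = 0 := by exact_mod_cast weight_det' i ν
  have h3 : (∑ k, (weight i k : ℝ) * offset k) = level i := by exact_mod_cast weight_offset i
  have : (∑ k, (weight i k : ℝ) * ‖z k‖ ^ 2) = level i := by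
    calc _ = (∑ k, (weight i k : ℝ) * det k (ν + 1)) * (‖w.1‖ ^ 2 - offset ν)
        + (∑ k, (weight i k : ℝ) * det ν k) * (‖w.2‖ ^ 2 - offset (ν + 1))
        + ∑ k, (weight i k : ℝ) * offset k := by
          rw [Finset.sum_mul, Finset.sum_mul, ← Finset.sum_add_distrib, ← Finset.sum_add_distrib]
          refine Finset.sum_congr rfl fun k _ => ?_
          rw [h, chartSq]; ring
      _ = _ := by rw [h1, h2, h3]; ring
  simp [momentum, this]

lemma sq_of_level (z : ZeroLevel) (k : Fin 8) :
    ‖z.1 k‖ ^ 2 = (normal k).1 * ‖z.1 0‖ ^ 2 + (normal k).2 * ‖z.1 2‖ ^ 2 + offset k := by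
  have h := fun i => congrFun z.2 i
  have h0 := h 0; have h1 := h 1; have h2 := h 2; have h3 := h 3; have h4 := h 4; have h5 := h 5
  simp [momentum, weight, level, Fin.sum_univ_eight] at h0 h1 h2 h3 h4 h5
  fin_cases k <;> simp [normal, offset] <;> linarith

lemma sq_eq_chartSq (ν : Fin 8) (z : ZeroLevel) (k : Fin 8) :
    ‖z.1 k‖ ^ 2 = chartSq ν (z.1 ν, z.1 (ν + 1)) k := by
  have e1 : (normal k).1 = det k (ν + 1) * (normal ν).1 + det ν k * (normal (ν + 1)).1 := by
    revert k ν; decide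
  have e2 : (normal k).2 = det k (ν + 1) * (normal ν).2 + det ν k * (normal (ν + 1)).2 := by
    revert k ν; decide
  rw [chartSq, sq_of_level z k, sq_of_level z ν, sq_of_level z (ν + 1), e1, e2]
  push_cast; ring

/-- The open subset of `ℂ²` on which the chart `φ_ν` is defined: all expressions under the square
roots are strictly positive. -/
def chartDomain (ν : Fin 8) : Set (ℂ × ℂ) :=
  {w | ∀ k, k ≠ ν → k ≠ ν + 1 → 0 < chartSq ν w k}

/-- The preferred representative of `φ_ν(w)`: `z_ν = w.1`, `z_{ν+1} = w.2`, and all other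
coordinates are positive real numbers. -/
noncomputable def chartRep (ν : Fin 8) (w : ℂ × ℂ) (k : Fin 8) : ℂ :=
  if k = ν then w.1 else if k = ν + 1 then w.2 else (Real.sqrt (chartSq ν w k) : ℂ)

lemma ne_succ (ν : Fin 8) : ν + 1 ≠ ν := by revert ν; decide

lemma chartRep_sq (ν : Fin 8) (w : ℂ × ℂ) (hw : w ∈ chartDomain ν) (k : Fin 8) :
    ‖chartRep ν w k‖ ^ 2 = chartSq ν w k := by
  by_cases h1 : k = ν
  · subst h1; simp [chartRep, chartSq, det_succ, det_self]
  by_cases h2 : k = ν + 1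
  · subst h2; simp [chartRep, chartSq, det_succ, det_self, ne_succ]
  have := hw k h1 h2
  simp [chartRep, h1, h2, Real.sq_sqrt this.le]

lemma momentum_chartRep (ν : Fin 8) (w : ℂ × ℂ) (hw : w ∈ chartDomain ν) :
    momentum (chartRep ν w) = 0 :=
  momentum_eq_zero_of_sq ν w _ (chartRep_sq ν w hw)

/-- The chart `φ_ν`, a map from an open subset of `ℂ²` to `M`. -/
noncomputable def phi (ν : Fin 8) (w : chartDomain ν) : M :=
  mk (chartRep ν w) (momentum_chartRep ν w w.2)

lemma zero_mem_chartDomain (ν : Fin 8) : ((0, 0) : ℂ × ℂ) ∈ chartDomain ν := by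
  intro k h1 h2
  have : 0 < det k (ν + 1) * (0 - offset ν) + det ν k * (0 - offset (ν + 1)) + offset k := by
    revert ν k; decide
  simp only [chartSq, norm_zero]
  have h3 : (0 : ℝ) < ((det k (ν + 1) * (0 - offset ν) + det ν k * (0 - offset (ν + 1))
    + offset k : ℤ) : ℝ) := by exact_mod_cast this
  push_cast at h3
  simpa using h3


def others (ν : Fin 8) : Finset (Fin 8) := Finset.univ.filter fun k => k ≠ ν ∧ k ≠ ν + 1

lemma mem_others {ν k : Fin 8} : k ∈ others ν ↔ k ≠ ν ∧ k ≠ ν + 1 := by simp [others]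

lemma prod_split {β : Type*} [CommMonoid β] (ν : Fin 8) (f : Fin 8 → β) :
    ∏ k, f k = f ν * f (ν + 1) * ∏ k ∈ others ν, f k := by
  have : (Finset.univ : Finset (Fin 8)) = insert ν (insert (ν + 1) (others ν)) := by
    ext k; simp only [Finset.mem_univ, Finset.mem_insert, mem_others]; tauto
  rw [this, Finset.prod_insert, Finset.prod_insert, mul_assoc]
  · simp [mem_others]
  · simp [mem_others, (ne_succ ν).symm]

/-- The inverse of `φ_ν` on representatives: the coordinates `z_ν`, `z_{ν+1}` after the other six
have been made positive by the torus action. -/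
noncomputable def chartCoord (ν : Fin 8) (z : Fin 8 → ℂ) : ℂ × ℂ :=
  (z ν * ∏ k ∈ others ν, (z k / (‖z k‖ : ℂ)) ^ det k (ν + 1),
   z (ν + 1) * ∏ k ∈ others ν, (z k / (‖z k‖ : ℂ)) ^ det ν k)

lemma prod_zpow_sum {ι : Type*} (s : Finset ι) (a : Circle) (f : ι → ℤ) :
    ∏ k ∈ s, a ^ f k = a ^ ∑ k ∈ s, f k := by
  classical
  induction s using Finset.induction_on with
  | empty => simp
  | insert i s hi ih => rw [Finset.prod_insert hi, Finset.sum_insert hi, zpow_add, ih]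

lemma coe_prod {ι : Type*} (s : Finset ι) (f : ι → Circle) :
    ((∏ k ∈ s, f k : Circle) : ℂ) = ∏ k ∈ s, (f k : ℂ) := map_prod Circle.coeHom f s

lemma prod_character (t : Torus6) (m : Fin 8 → ℤ) (hm : ∀ i, ∑ k, weight i k * m k = 0) :
    ∏ k, character t k ^ m k = 1 := by
  simp only [character, ← Finset.prod_zpow, ← zpow_mul]
  rw [Finset.prod_comm]
  refine Finset.prod_eq_one fun i _ => ?_
  rw [prod_zpow_sum, hm, zpow_zero]

lemma character_coord (t : Torus6) (ν l : Fin 8) (m : Fin 8 → ℤ)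
    (hm : ∀ i, ∑ k, weight i k * m k = 0)
    (hl : character t ν ^ m ν * character t (ν + 1) ^ m (ν + 1) = character t l)
    (z : Fin 8 → ℂ) :
    (character t l : ℂ) * z l * ∏ k ∈ others ν,
      ((character t k : ℂ) * z k / (‖(character t k : ℂ) * z k‖ : ℂ)) ^ m k =
    z l * ∏ k ∈ others ν, (z k / (‖z k‖ : ℂ)) ^ m k := by
  have h := prod_character t m hm
  rw [prod_split ν, hl] at h
  have h' : (character t l : ℂ) * ∏ k ∈ others ν, (character t k : ℂ) ^ m k = 1 := by
    have := congrArg (fun c : Circle => (c : ℂ)) h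
    simpa [coe_prod] using this
  simp only [norm_mul, Circle.norm_coe, one_mul, mul_div_assoc, mul_zpow, Finset.prod_mul_distrib]
  linear_combination (z l * ∏ k ∈ others ν, (z k / (‖z k‖ : ℂ)) ^ m k) * h'

lemma chartCoord_smul (ν : Fin 8) (t : Torus6) (z : Fin 8 → ℂ) :
    chartCoord ν (fun k => (character t k : ℂ) * z k) = chartCoord ν z := by
  refine Prod.ext ?_ ?_
  · exact character_coord t ν ν (fun k => det k (ν + 1)) (fun i => weight_det i _)
      (by simp [det_succ, det_self]) z
  · exact character_coord t ν (ν + 1) (fun k => det ν k) (fun i => weight_det' i _)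
      (by simp [det_succ, det_self]) z

/-- The open set `U_ν ⊆ M` of all `[z]` with `z_k ≠ 0` for `k ≠ ν, ν + 1`. -/
noncomputable def chartSource (ν : Fin 8) : Set M :=
  {p | lift (fun z => ∀ k, k ≠ ν → k ≠ ν + 1 → z k ≠ 0) (by intro t z; simp) p}

/-- The inverse of `φ_ν` on `U_ν`. -/
noncomputable def chartMap (ν : Fin 8) : M → ℂ × ℂ := lift (chartCoord ν) (chartCoord_smul ν)

lemma exists_character (τ : Fin 8 → Circle) (ν : Fin 8)
    (h1 : ∏ k, τ k ^ det k (ν + 1) = 1) (h2 : ∏ k, τ k ^ det ν k = 1) :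
    ∃ t : Torus6, ∀ k, character t k = τ k := by
  have key : ∀ l, ∏ k, τ k ^ det k l = 1 := by
    intro l
    have : ∀ k, τ k ^ det k l = (τ k ^ det k (ν + 1)) ^ det ν l * (τ k ^ det ν k) ^ det (ν + 1) l := by
      intro k
      rw [← zpow_mul, ← zpow_mul, ← zpow_add, ← det_rel]
    rw [Finset.prod_congr rfl fun k _ => this k, Finset.prod_mul_distrib, Finset.prod_zpow,
      Finset.prod_zpow, h1, h2]; simp
  have k0 := key 0
  have k2 := key 2
  simp [Fin.prod_univ_eight, det, normal] at k0 k2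
  refine ⟨![τ 0, τ 1, τ 2, τ 3, (τ 5)⁻¹, τ 7], fun k => ?_⟩
  have e4 : τ 4 = τ 0 * τ 1 * (τ 3)⁻¹ * (τ 5)⁻¹ * τ 7 := by
    rw [← mul_right_inj (τ 4)⁻¹, inv_mul_cancel, ← k2]
    simp only [mul_assoc, mul_comm, mul_left_comm]
  have e6 : τ 6 = τ 1 * τ 2 * τ 3 * (τ 5)⁻¹ * (τ 7)⁻¹ := by
    rw [← inv_inj, ← mul_right_inj (τ 6), mul_inv_cancel, ← k0]
    simp only [mul_inv, inv_inv, mul_assoc, mul_comm, mul_left_comm]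
  fin_cases k <;> simp [character, Fin.prod_univ_six, weight, e4, e6]

lemma phi_chartMap (ν : Fin 8) (z : ZeroLevel) (hz : ∀ k, k ≠ ν → k ≠ ν + 1 → z.1 k ≠ 0) :
    ∃ h : chartCoord ν z.1 ∈ chartDomain ν, phi ν ⟨chartCoord ν z.1, h⟩ = mk z.1 z.2 := by
  have hu : ∀ k ∈ others ν, ‖z.1 k / (‖z.1 k‖ : ℂ)‖ = 1 := by
    intro k hk
    rw [mem_others] at hk
    have := hz k hk.1 hk.2
    simp [this]
  have hn : ∀ m : Fin 8 → ℤ, ‖∏ k ∈ others ν, (z.1 k / (‖z.1 k‖ : ℂ)) ^ m k‖ = 1 := by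
    intro m
    rw [norm_prod]
    exact Finset.prod_eq_one fun k hk => by rw [norm_zpow, hu k hk, one_zpow]
  have hsq : ∀ k, chartSq ν (chartCoord ν z.1) k = ‖z.1 k‖ ^ 2 := by
    intro k
    rw [sq_eq_chartSq ν z k]
    simp only [chartSq, chartCoord, norm_mul, hn, mul_one]
  have hmem : chartCoord ν z.1 ∈ chartDomain ν := by
    intro k h1 h2
    rw [hsq]
    have := hz k h1 h2
    positivity
  refine ⟨hmem, ?_⟩
  have hc : ∀ k, ∃ c : Circle, k ∈ others ν → (c : ℂ) = z.1 k / (‖z.1 k‖ : ℂ) := by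
    intro k
    by_cases hk : k ∈ others ν
    · exact ⟨⟨_, mem_sphere_zero_iff_norm.2 (hu k hk)⟩, fun _ => rfl⟩
    · exact ⟨1, fun h => absurd h hk⟩
  choose c hc using hc
  have hcp : ∀ m : Fin 8 → ℤ, ((∏ k ∈ others ν, c k ^ m k : Circle) : ℂ) =
      ∏ k ∈ others ν, (z.1 k / (‖z.1 k‖ : ℂ)) ^ m k := by
    intro m
    rw [coe_prod]
    exact Finset.prod_congr rfl fun k hk => by rw [Circle.coe_zpow, hc k hk]
  let τ : Fin 8 → Circle := fun k =>
    if k = ν then ∏ k ∈ others ν, c k ^ det k (ν + 1)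
    else if k = ν + 1 then ∏ k ∈ others ν, c k ^ det ν k else (c k)⁻¹
  have τ0 : τ ν = ∏ k ∈ others ν, c k ^ det k (ν + 1) := by simp [τ]
  have τ1 : τ (ν + 1) = ∏ k ∈ others ν, c k ^ det ν k := by simp [τ]
  have τ2 : ∀ k ∈ others ν, τ k = (c k)⁻¹ := by
    intro k hk
    rw [mem_others] at hk
    simp [τ, hk.1, hk.2]
  have τp : ∀ m : Fin 8 → ℤ, ∏ k ∈ others ν, τ k ^ m k = (∏ k ∈ others ν, c k ^ m k)⁻¹ := by
    intro m
    rw [← Finset.prod_inv_distrib]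
    exact Finset.prod_congr rfl fun k hk => by rw [τ2 k hk, inv_zpow]
  obtain ⟨t, ht⟩ := exists_character τ ν
    (by rw [prod_split ν, τp, det_succ, det_self, ← τ0]; simp)
    (by rw [prod_split ν, τp, det_succ, det_self, ← τ1]; simp)
  refine Quotient.sound ⟨t, ?_⟩
  apply Subtype.ext
  funext k
  change (character t k : ℂ) * z.1 k = chartRep ν (chartCoord ν z.1) k
  rw [ht]
  by_cases h1 : k = ν
  · subst h1
    rw [τ0, hcp]; simp [chartRep, chartCoord, mul_comm]
  by_cases h2 : k = ν + 1
  · subst h2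
    rw [τ1, hcp]; simp [chartRep, chartCoord, mul_comm]
  have hk : k ∈ others ν := mem_others.2 ⟨h1, h2⟩
  rw [τ2 k hk, Circle.coe_inv, hc k hk]
  simp only [chartRep, h1, h2, if_false, hsq, Real.sqrt_sq (norm_nonneg _)]
  have := hz k h1 h2
  field_simp

lemma chartCoord_chartRep (ν : Fin 8) (w : ℂ × ℂ) (hw : w ∈ chartDomain ν) :
    chartCoord ν (chartRep ν w) = w := by
  have : ∀ k ∈ others ν, chartRep ν w k / (‖chartRep ν w k‖ : ℂ) = 1 := by
    intro k hk
    rw [mem_others] at hk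
    have h := hw k hk.1 hk.2
    have h' := Real.sqrt_pos.2 h
    simp [chartRep, hk.1, hk.2, abs_of_pos h', h'.ne']
  have hp : ∀ m : Fin 8 → ℤ, ∏ k ∈ others ν, (chartRep ν w k / (‖chartRep ν w k‖ : ℂ)) ^ m k = 1 :=
    fun m => Finset.prod_eq_one fun k hk => by rw [this k hk, one_zpow]
  simp only [chartCoord, hp, mul_one]
  simp [chartRep, ne_succ]

lemma continuous_coord (k : Fin 8) : Continuous fun z : ZeroLevel => z.1 k :=
  (continuous_apply k).comp continuous_subtype_val

instance : ContinuousConstSMul Torus6 ZeroLevel where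
  continuous_const_smul t :=
    Continuous.subtype_mk (continuous_pi fun k => continuous_const.mul (continuous_coord k)) _

/-- The quotient map `𝓛⁻¹(0) → M`. -/
noncomputable def proj : ZeroLevel → M := Quotient.mk _

lemma isOpenQuotientMap_proj : IsOpenQuotientMap proj :=
  MulAction.isOpenQuotientMap_quotientMk (Γ := Torus6) (T := ZeroLevel)

lemma isOpen_chartSource (ν : Fin 8) : IsOpen (chartSource ν) := by
  rw [← isOpenQuotientMap_proj.isQuotientMap.isOpen_preimage]
  have : proj ⁻¹' chartSource ν = ⋂ k ∈ others ν, {z : ZeroLevel | z.1 k ≠ 0} := by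
    ext z
    simp only [Set.mem_iInter, mem_others, and_imp]
    rfl
  rw [this]
  exact isOpen_biInter_finset fun k _ => isOpen_ne_fun (continuous_coord k) continuous_const

lemma contDiff_chartSq (ν k : Fin 8) : ContDiff ℝ ∞ fun w => chartSq ν w k := by
  unfold chartSq
  have h1 : ContDiff ℝ ∞ fun w : ℂ × ℂ => ‖w.1‖ ^ 2 := contDiff_fst.norm_sq ℝ
  have h2 : ContDiff ℝ ∞ fun w : ℂ × ℂ => ‖w.2‖ ^ 2 := contDiff_snd.norm_sq ℝ
  fun_prop

lemma isOpen_chartDomain (ν : Fin 8) : IsOpen (chartDomain ν) := by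
  have : chartDomain ν = ⋂ k ∈ others ν, {w | 0 < chartSq ν w k} := by
    ext w
    simp only [Set.mem_iInter, mem_others, and_imp]
    rfl
  rw [this]
  exact isOpen_biInter_finset fun k _ =>
    isOpen_lt continuous_const (contDiff_chartSq ν k).continuous

lemma contDiffAt_chartRep (ν k : Fin 8) {w : ℂ × ℂ} (hw : w ∈ chartDomain ν) :
    ContDiffAt ℝ ∞ (fun w => chartRep ν w k) w := by
  by_cases h1 : k = ν
  · simp only [chartRep, h1, if_true]; exact contDiffAt_fst
  by_cases h2 : k = ν + 1
  · simp only [chartRep, h1, h2, ne_succ, if_true, if_false]; exact contDiffAt_snd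
  simp only [chartRep, h1, h2, if_false]
  exact Complex.ofRealCLM.contDiff.contDiffAt.comp w
    ((contDiff_chartSq ν k).contDiffAt.sqrt (hw k h1 h2).ne')

lemma contDiffAt_zpow {f : ℂ × ℂ → ℂ} {w : ℂ × ℂ} (hf : ContDiffAt ℝ ∞ f w) (h : f w ≠ 0)
    (m : ℤ) : ContDiffAt ℝ ∞ (fun w => f w ^ m) w := by
  cases m with
  | ofNat n => simpa using hf.pow n
  | negSucc n =>
    simp only [zpow_negSucc]
    exact (hf.pow (n + 1)).inv (pow_ne_zero _ h)

lemma contDiffAt_chartCoord (ν : Fin 8) {f : ℂ × ℂ → Fin 8 → ℂ} {w : ℂ × ℂ}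
    (hf : ∀ k, ContDiffAt ℝ ∞ (fun w => f w k) w) (h : ∀ k ∈ others ν, f w k ≠ 0) :
    ContDiffAt ℝ ∞ (fun w => chartCoord ν (f w)) w := by
  have key : ∀ m : Fin 8 → ℤ, ContDiffAt ℝ ∞
      (fun w => ∏ k ∈ others ν, (f w k / (‖f w k‖ : ℂ)) ^ m k) w := by
    intro m
    refine contDiffAt_prod fun k hk => contDiffAt_zpow ?_ ?_ _
    · simp only [div_eq_mul_inv]
      refine (hf k).mul (ContDiffAt.inv ?_ ?_)
      · exact Complex.ofRealCLM.contDiff.contDiffAt.comp w ((hf k).norm ℝ (h k hk))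
      · simpa using h k hk
    · simpa using h k hk
  exact ((hf ν).mul (key _)).prodMk ((hf (ν + 1)).mul (key _))

lemma continuousAt_chartCoord (ν : Fin 8) {z : ZeroLevel} (h : ∀ k ∈ others ν, z.1 k ≠ 0) :
    ContinuousAt (fun z : ZeroLevel => chartCoord ν z.1) z := by
  have key : ∀ m : Fin 8 → ℤ, ContinuousAt
      (fun z : ZeroLevel => ∏ k ∈ others ν, (z.1 k / (‖z.1 k‖ : ℂ)) ^ m k) z := by
    intro m
    refine tendsto_finsetProd _ fun k hk => ?_
    refine ContinuousAt.zpow₀ ?_ _ (Or.inl (by simpa using h k hk))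
    refine (continuous_coord k).continuousAt.div ?_ (by simpa using h k hk)
    exact (Complex.continuous_ofReal.comp (continuous_coord k).norm).continuousAt
  exact ((continuous_coord ν).continuousAt.mul (key _)).prodMk
    ((continuous_coord (ν + 1)).continuousAt.mul (key _))

lemma proj_surjective (p : M) : ∃ z : ZeroLevel, proj z = p := Quotient.exists_rep p

open Classical in
/-- The chart `(U_ν, φ_ν)` of `M`; its inverse `(chart ν).symm` is `phi ν` on `chartDomain ν`. -/
noncomputable def chart (ν : Fin 8) : OpenPartialHomeomorph M (ℂ × ℂ) where
  toFun := chartMap ν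
  invFun w := if h : w ∈ chartDomain ν then phi ν ⟨w, h⟩ else phi ν ⟨(0, 0), zero_mem_chartDomain ν⟩
  source := chartSource ν
  target := chartDomain ν
  map_source' p hp := by
    obtain ⟨z, rfl⟩ := proj_surjective p
    exact (phi_chartMap ν z hp).1
  map_target' w hw := by
    rw [dif_pos hw]
    intro k h1 h2
    have := Real.sqrt_pos.2 (hw k h1 h2)
    simpa [chartRep, h1, h2] using this.ne'
  left_inv' p hp := by
    obtain ⟨z, rfl⟩ := proj_surjective p
    obtain ⟨h, e⟩ := phi_chartMap ν z hp
    exact (dif_pos h).trans e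
  right_inv' w hw := by
    rw [dif_pos hw]
    exact chartCoord_chartRep ν w hw
  open_source := isOpen_chartSource ν
  open_target := isOpen_chartDomain ν
  continuousOn_toFun p hp := by
    obtain ⟨z, rfl⟩ := proj_surjective p
    refine ContinuousAt.continuousWithinAt ?_
    refine (isOpenQuotientMap_proj.continuousAt_comp_iff).1 ?_
    exact continuousAt_chartCoord ν fun k hk => hp k (mem_others.1 hk).1 (mem_others.1 hk).2
  continuousOn_invFun := by
    rw [continuousOn_iff_continuous_domRestrict]
    have : Set.domRestrict (chartDomain ν) (fun w => if h : w ∈ chartDomain ν then phi ν ⟨w, h⟩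
        else phi ν ⟨(0, 0), zero_mem_chartDomain ν⟩) = fun w : chartDomain ν => proj ⟨chartRep ν w, momentum_chartRep ν w w.2⟩ := by
      funext w
      exact dif_pos w.2
    rw [this]
    refine isOpenQuotientMap_proj.continuous.comp (Continuous.subtype_mk ?_ _)
    refine continuous_pi fun k => continuous_iff_continuousAt.2 fun w => ?_
    exact (contDiffAt_chartRep ν k w.2).continuousAt.comp continuousAt_subtype_val

lemma adjacent_of_zero (X Y : ℝ)
    (h : ∀ k, 0 ≤ ((normal k).1 : ℝ) * X + (normal k).2 * Y + offset k) (j k : Fin 8)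
    (hj : ((normal j).1 : ℝ) * X + (normal j).2 * Y + offset j = 0)
    (hk : ((normal k).1 : ℝ) * X + (normal k).2 * Y + offset k = 0) :
    j = k ∨ j = k + 1 ∨ k = j + 1 := by
  have h0 := h 0; have h1 := h 1; have h2 := h 2; have h3 := h 3
  have h4 := h 4; have h5 := h 5; have h6 := h 6; have h7 := h 7
  clear h
  simp [normal, offset] at h0 h1 h2 h3 h4 h5 h6 h7
  fin_cases j <;> fin_cases k <;> first | decide | (exfalso; simp [normal, offset] at hj hk; linarith)

lemma exists_chart (p : M) : ∃ ν, p ∈ (chart ν).source := by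
  obtain ⟨z, rfl⟩ := proj_surjective p
  have hadj : ∀ j k, z.1 j = 0 → z.1 k = 0 → j = k ∨ j = k + 1 ∨ k = j + 1 := by
    intro j k hj hk
    refine adjacent_of_zero (‖z.1 0‖ ^ 2) (‖z.1 2‖ ^ 2) (fun k => ?_) j k ?_ ?_
    · rw [← sq_of_level z]; positivity
    · rw [← sq_of_level z, hj]; simp
    · rw [← sq_of_level z, hk]; simp
  by_cases h0 : ∃ k, z.1 k = 0
  · obtain ⟨k, hk⟩ := h0
    by_cases h1 : z.1 (k + 1) = 0
    · refine ⟨k, fun j hj1 hj2 hj => ?_⟩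
      have a := hadj j k hj hk
      have b := hadj j (k + 1) hj h1
      have : ∀ j k : Fin 8, j ≠ k → j ≠ k + 1 → (j = k ∨ j = k + 1 ∨ k = j + 1) →
        ¬ (j = k + 1 ∨ j = k + 1 + 1 ∨ k + 1 = j + 1) := by decide
      exact this j k hj1 hj2 a b
    · refine ⟨k - 1, fun j hj1 hj2 hj => ?_⟩
      have a := hadj j k hj hk
      have : ∀ j k : Fin 8, j ≠ k - 1 → j ≠ k - 1 + 1 → (j = k ∨ j = k + 1 ∨ k = j + 1) →
        j = k + 1 := by decide
      exact h1 (this j k hj1 hj2 a ▸ hj)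
  · push Not at h0
    exact ⟨0, fun k _ _ => h0 k⟩

/-- The atlas of the eight charts `(U_ν, φ_ν)`. -/
noncomputable instance : ChartedSpace (ℂ × ℂ) M where
  atlas := Set.range chart
  chartAt p := chart (exists_chart p).choose
  mem_chart_source p := (exists_chart p).choose_spec
  chart_mem_atlas p := Set.mem_range_self _

instance : IsManifold 𝓘(ℝ, ℂ × ℂ) ∞ M := by
  refine isManifold_of_contDiffOn _ _ _ ?_
  rintro _ _ ⟨ν, rfl⟩ ⟨μ, rfl⟩ w hw
  simp only [modelWithCornersSelf_coe_symm, Set.preimage_id, modelWithCornersSelf_coe,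
    Set.range_id, Set.inter_univ, OpenPartialHomeomorph.trans_source,
    OpenPartialHomeomorph.symm_source, Set.mem_inter_iff, Set.mem_preimage] at hw
  have hw1 : w ∈ chartDomain ν := hw.1
  have hinv : ∀ v, ∀ hv : v ∈ chartDomain ν,
      (chart ν).symm v = proj ⟨chartRep ν v, momentum_chartRep ν v hv⟩ := fun v hv => dif_pos hv
  have h2 := hw.2
  rw [hinv w hw1] at h2
  refine ContDiffAt.contDiffWithinAt ?_
  have := contDiffAt_chartCoord μ (f := chartRep ν) (w := w)
    (fun k => contDiffAt_chartRep ν k hw1)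
    (fun k hk => h2 k (mem_others.1 hk).1 (mem_others.1 hk).2)
  refine this.congr_of_eventuallyEq ?_
  filter_upwards [(isOpen_chartDomain ν).mem_nhds hw1] with v hv
  exact congrArg (chart μ) (hinv v hv)

lemma character_gamma (t : Torus6) :
    character t 1 * character t 2 * character t 3 =
      character t 5 * character t 6 * character t 7 := by
  have h := prod_character t ![0, -1, -1, -1, 0, 1, 1, 1] (by decide)
  simp [Fin.prod_univ_eight] at h
  rw [← mul_right_inj (character t 1 * character t 2 * character t 3)⁻¹, inv_mul_cancel, ← h]
  simp only [mul_inv, mul_assoc, mul_comm, mul_left_comm]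

/-- `J([z]) = |z_1|² / 2`. -/
noncomputable def J : M → ℝ := lift (fun z => ‖z 0‖ ^ 2 / 2) (by
    intro t z; simp only [norm_mul, Circle.norm_coe, one_mul])

/-- `H([z]) = |z_3|² / 2`. -/
noncomputable def H : M → ℝ := lift (fun z => ‖z 2‖ ^ 2 / 2) (by
    intro t z; simp only [norm_mul, Circle.norm_coe, one_mul])

/-- `γ_1([z])` is the real part of `conj (z_2 z_3 z_4) z_6 z_7 z_8`, divided by `50`. -/
noncomputable def gamma1 : M → ℝ :=
  lift (fun z => 1 / 50 * ((starRingEnd ℂ) (z 1 * z 2 * z 3) * z 5 * z 6 * z 7).re) (by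
    intro t z
    have h := congrArg (fun c : Circle => (c : ℂ)) (character_gamma t)
    have h' : (starRingEnd ℂ) ((character t 1 * character t 2 * character t 3 : Circle) : ℂ) *
        ((character t 1 * character t 2 * character t 3 : Circle) : ℂ) = 1 := by
      rw [← Circle.coe_inv_eq_conj, ← Circle.coe_mul, inv_mul_cancel, Circle.coe_one]
    simp only [Circle.coe_mul, map_mul] at h h' ⊢
    congr 2
    linear_combination (starRingEnd ℂ (z 1) * starRingEnd ℂ (z 2) * starRingEnd ℂ (z 3) *
      z 5 * z 6 * z 7) * (h' - starRingEnd ℂ (character t 1 : ℂ) *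
      starRingEnd ℂ (character t 2 : ℂ) * starRingEnd ℂ (character t 3 : ℂ) * h))

/-- `γ_2([z]) = |z_5|⁴ |z_4|⁴ / 50`. -/
noncomputable def gamma2 : M → ℝ :=
  lift (fun z => 1 / 50 * ‖z 4‖ ^ 4 * ‖z 3‖ ^ 4) (by
    intro t z; simp only [norm_mul, Circle.norm_coe, one_mul])

/-- `γ_3([z]) = |z_4|⁴ |z_7|⁴ / 50`. -/
noncomputable def gamma3 : M → ℝ :=
  lift (fun z => 1 / 50 * ‖z 3‖ ^ 4 * ‖z 6‖ ^ 4) (by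
    intro t z; simp only [norm_mul, Circle.norm_coe, one_mul])

/-- `γ_4([z]) = |z_5|⁴ |z_7|⁴ / 100`. -/
noncomputable def gamma4 : M → ℝ :=
  lift (fun z => 1 / 100 * ‖z 4‖ ^ 4 * ‖z 6‖ ^ 4) (by
    intro t z; simp only [norm_mul, Circle.norm_coe, one_mul])

/-- `H_t = (1 - 2 t_1) H + t_1 γ_1 + t_2 γ_2 + t_3 γ_3 + t_4 γ_4`. -/
noncomputable def Ht (t : Fin 4 → ℝ) (p : M) : ℝ :=
  (1 - 2 * t 0) * H p + t 0 * gamma1 p + t 1 * gamma2 p + t 2 * gamma3 p + t 3 * gamma4 p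

/-- `F_t = (J, H_t) : M → ℝ²`. -/
noncomputable def Ft (t : Fin 4 → ℝ) (p : M) : ℝ × ℝ := (J p, Ht t p)

/-- The rank of the differential `dF(p)` of a map `F : M → ℝ²`. -/
noncomputable def rankAt (F : M → ℝ × ℝ) (p : M) : ℕ :=
  Module.finrank ℝ (LinearMap.range (mfderiv 𝓘(ℝ, ℂ × ℂ) 𝓘(ℝ, ℝ × ℝ) F p).toLinearMap)

/-- `p` is a singular point of rank `r` of `F : M → ℝ²`: `F` is differentiable at `p` and `dF(p)`
has rank `r`, which is less than the maximal rank `2`. -/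
def IsSingularPointOfRank (F : M → ℝ × ℝ) (p : M) (r : ℕ) : Prop :=
  MDifferentiableAt 𝓘(ℝ, ℂ × ℂ) 𝓘(ℝ, ℝ × ℝ) F p ∧ rankAt F p = r ∧ r < 2

/-- The point `[√2, 0, 0, √2, 2, 2√2, √6, √6]`. -/
noncomputable def point2 : M :=
  mk ![(√2 : ℝ), 0, 0, (√2 : ℝ), 2, 2 * (√2 : ℝ), (√6 : ℝ), (√6 : ℝ)] (by
    funext i
    fin_cases i <;> simp [momentum, weight, level, Fin.sum_univ_eight, mul_pow] <;> norm_num)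

/-- The point `[2, √2, 0, 0, √2, √6, √6, 2√2]`. -/
noncomputable def point3 : M :=
  mk ![2, (√2 : ℝ), 0, 0, (√2 : ℝ), (√6 : ℝ), (√6 : ℝ), 2 * (√2 : ℝ)] (by
    funext i
    fin_cases i <;> simp [momentum, weight, level, Fin.sum_univ_eight, mul_pow] <;> norm_num)

/-- The point `[2, 2√2, √6, √6, √2, 0, 0, √2]`. -/
noncomputable def point6 : M :=
  mk ![2, 2 * (√2 : ℝ), (√6 : ℝ), (√6 : ℝ), (√2 : ℝ), 0, 0, (√2 : ℝ)] (by
    funext i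
    fin_cases i <;> simp [momentum, weight, level, Fin.sum_univ_eight, mul_pow] <;> norm_num)

/-- The point `[√2, √6, √6, 2√2, 2, √2, 0, 0]`. -/
noncomputable def point7 : M :=
  mk ![(√2 : ℝ), (√6 : ℝ), (√6 : ℝ), 2 * (√2 : ℝ), 2, (√2 : ℝ), 0, 0] (by
    funext i
    fin_cases i <;> simp [momentum, weight, level, Fin.sum_univ_eight, mul_pow] <;> norm_num)

end Octagon

/-!
In the chart `φ_ν` every function on `M` induced by a smooth function `G` on `ℂ⁸` is smooth. The
squared norms `|z_k|²` of the representative `chartRep ν w` depend only on `|w.1|²` and `|w.2|²`, so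
replacing `w` by `-w` flips the signs of the coordinates `ν`, `ν + 1` and fixes the others
(`chartRep_neg`). If `G` is invariant under this sign flip, its expression in the chart is thus an
even function of `w`, and the derivative of an even function vanishes at the origin
(`hasFDerivAt_zero_of_even`). Hence `φ_ν(0, 0)` is a singular point of rank zero
(`isSingularPointOfRank_phi_zero`).

The functions `J`, `H`, `γ_2`, `γ_3`, `γ_4` depend only on the norms of the coordinates, so they are
invariant under all sign flips. The function `γ_1` is invariant when both or neither of
`ν`, `ν + 1` occur among the coordinates `z_2, z_3, z_4, z_6, z_7, z_8` in its definition; this holds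
for the corners `φ_2`, `φ_3`, `φ_6`, `φ_7` and fails for the remaining four.
(In this paragraph indices start at one; in the code they start at zero, so these corners are
`phi 1`, `phi 2`, `phi 5`, `phi 6`.)
-/

namespace Octagon

open scoped Manifold ContDiff

/-! ### Even functions in a chart -/

lemma hasFDerivAt_zero_of_even {E F : Type*} [NormedAddCommGroup E] [NormedSpace ℝ E]
    [NormedAddCommGroup F] [NormedSpace ℝ F] {g : E → F} (hg : DifferentiableAt ℝ g 0)
    (h : ∀ᶠ w in nhds 0, g (-w) = g w) : HasFDerivAt g (0 : E →L[ℝ] F) 0 := by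
  have h1 : HasFDerivAt g (fderiv ℝ g 0) (-0) := by simpa using hg.hasFDerivAt
  have h2 := (h1.comp (0 : E) (hasFDerivAt_id (0 : E)).fun_neg).congr_of_eventuallyEq
    (h.mono fun w hw => hw.symm)
  have h3 := hg.hasFDerivAt.unique h2
  convert hg.hasFDerivAt
  ext v
  have h4 : fderiv ℝ g 0 v = -fderiv ℝ g 0 v := by simpa using DFunLike.congr_fun h3 v
  have h5 : (2 : ℝ) • fderiv ℝ g 0 v = 0 := by rw [two_smul]; exact eq_neg_iff_add_eq_zero.1 h4
  simpa using ((smul_eq_zero_iff_right two_ne_zero).1 h5).symm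

/-- The sign flip of the coordinates `ν` and `ν + 1` on `ℂ⁸`. -/
def signFlip (ν : Fin 8) (z : Fin 8 → ℂ) (k : Fin 8) : ℂ :=
  if k = ν ∨ k = ν + 1 then -z k else z k

lemma norm_signFlip (ν : Fin 8) (z : Fin 8 → ℂ) (k : Fin 8) : ‖signFlip ν z k‖ = ‖z k‖ := by
  unfold signFlip; split_ifs <;> simp

lemma chartSq_neg (ν : Fin 8) (w : ℂ × ℂ) (k : Fin 8) : chartSq ν (-w) k = chartSq ν w k := by
  simp [chartSq]

lemma chartRep_neg (ν : Fin 8) (w : ℂ × ℂ) : chartRep ν (-w) = signFlip ν (chartRep ν w) := by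
  funext k
  by_cases h1 : k = ν
  · simp [chartRep, signFlip, h1]
  by_cases h2 : k = ν + 1
  · simp [chartRep, signFlip, h2]
  · simp [chartRep, signFlip, h1, h2, chartSq_neg]

/-- A function on `M` induced by a smooth function on `ℂ⁸` that is invariant under the sign flip of
the coordinates `ν` and `ν + 1` has vanishing differential at the corner `φ_ν(0, 0)`. -/
lemma isSingularPointOfRank_phi_zero (ν : Fin 8) {F : M → ℝ × ℝ} {G : (Fin 8 → ℂ) → ℝ × ℝ}
    (hG : ContDiff ℝ ∞ G) (hFG : ∀ z : ZeroLevel, F (proj z) = G z.1)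
    (hflip : ∀ z, G (signFlip ν z) = G z) :
    IsSingularPointOfRank F (phi ν ⟨(0, 0), zero_mem_chartDomain ν⟩) 0 := by
  set p := phi ν ⟨(0, 0), zero_mem_chartDomain ν⟩
  have hsymm : (chart ν).symm (0, 0) = p := dif_pos (zero_mem_chartDomain ν)
  have hsource : p ∈ (chart ν).source :=
    hsymm ▸ (chart ν).map_target (zero_mem_chartDomain ν)
  have hchart : chart ν p = 0 := by
    rw [← hsymm]; exact (chart ν).right_inv (zero_mem_chartDomain ν)
  have hrep : ContDiffAt ℝ ∞ (chartRep ν) 0 :=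
    contDiffAt_pi.2 fun k => contDiffAt_chartRep ν k (zero_mem_chartDomain ν)
  have hg : HasFDerivAt (fun w => G (chartRep ν w)) (0 : ℂ × ℂ →L[ℝ] ℝ × ℝ) 0 := by
    refine hasFDerivAt_zero_of_even ?_ (.of_forall fun w => ?_)
    · exact (hG.contDiffAt.comp (0 : ℂ × ℂ) hrep).differentiableAt (by simp)
    · simp only [chartRep_neg, hflip]
  have hc : MDifferentiableAt 𝓘(ℝ, ℂ × ℂ) 𝓘(ℝ, ℂ × ℂ) (chart ν) p :=
    mdifferentiableAt_atlas (Set.mem_range_self ν) hsource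
  -- Near `p`, the function `F` is its expression in the chart `φ_ν` composed with that chart.
  have hF : F =ᶠ[nhds p] (fun w => G (chartRep ν w)) ∘ chart ν := by
    filter_upwards [(chart ν).open_source.mem_nhds hsource] with q hq
    have hw : chart ν q ∈ chartDomain ν := (chart ν).map_source hq
    have hq' : proj ⟨chartRep ν (chart ν q), momentum_chartRep ν _ hw⟩ = q :=
      (dif_pos hw).symm.trans ((chart ν).left_inv hq)
    conv_lhs => rw [← hq']
    exact hFG _
  have hd := (HasMFDerivAt.comp p (hchart ▸ hg.hasMFDerivAt) hc.hasMFDerivAt).congr_of_eventuallyEq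
    hF
  refine ⟨hd.mdifferentiableAt, ?_, by norm_num⟩
  have h0 : mfderiv 𝓘(ℝ, ℂ × ℂ) 𝓘(ℝ, ℝ × ℝ) F p = 0 :=
    hd.mfderiv.trans (ContinuousLinearMap.zero_comp _)
  rw [rankAt, h0]
  exact (congrArg (fun S : Submodule ℝ (ℝ × ℝ) => Module.finrank ℝ S) LinearMap.range_zero).trans
    (finrank_bot ℝ (ℝ × ℝ))

/-! ### The functions `J` and `H_t` on `ℂ⁸` -/

/-- The `𝕋⁶`-invariant function on `ℂ⁸` that induces `F_t = (J, H_t)` on `M`. -/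
noncomputable def liftedFt (t : Fin 4 → ℝ) (z : Fin 8 → ℂ) : ℝ × ℝ :=
  (‖z 0‖ ^ 2 / 2,
    (1 - 2 * t 0) * (‖z 2‖ ^ 2 / 2)
      + t 0 * (1 / 50 * ((starRingEnd ℂ) (z 1 * z 2 * z 3) * z 5 * z 6 * z 7).re)
      + t 1 * (1 / 50 * ‖z 4‖ ^ 4 * ‖z 3‖ ^ 4) + t 2 * (1 / 50 * ‖z 3‖ ^ 4 * ‖z 6‖ ^ 4)
      + t 3 * (1 / 100 * ‖z 4‖ ^ 4 * ‖z 6‖ ^ 4))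

lemma Ft_proj (t : Fin 4 → ℝ) (z : ZeroLevel) : Ft t (proj z) = liftedFt t z.1 := rfl

lemma contDiff_liftedFt (t : Fin 4 → ℝ) : ContDiff ℝ ∞ (liftedFt t) := by
  have hz : ∀ k, ContDiff ℝ ∞ fun z : Fin 8 → ℂ => z k := fun k => contDiff_apply ℝ ℂ k
  have h2 : ∀ k, ContDiff ℝ ∞ fun z : Fin 8 → ℂ => ‖z k‖ ^ 2 := fun k => (hz k).norm_sq ℝ
  -- The norm is not smooth at zero, but its even powers are.
  have h4 : ∀ k, ContDiff ℝ ∞ fun z : Fin 8 → ℂ => ‖z k‖ ^ 4 := fun k => by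
    simpa only [← pow_mul] using (h2 k).pow 2
  have hre : ContDiff ℝ ∞ fun z : Fin 8 → ℂ =>
      ((starRingEnd ℂ) (z 1 * z 2 * z 3) * z 5 * z 6 * z 7).re :=
    Complex.reCLM.contDiff.comp
      ((((Complex.conjCLE.contDiff.comp (((hz 1).mul (hz 2)).mul (hz 3))).mul (hz 5)).mul
        (hz 6)).mul (hz 7))
  unfold liftedFt
  fun_prop

lemma liftedFt_signFlip (t : Fin 4 → ℝ) {ν : Fin 8} (hν : ν = 1 ∨ ν = 2 ∨ ν = 5 ∨ ν = 6)
    (z : Fin 8 → ℂ) : liftedFt t (signFlip ν z) = liftedFt t z := by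
  simp only [liftedFt, norm_signFlip]
  rcases hν with rfl | rfl | rfl | rfl <;> simp [signFlip]

lemma isSingularPointOfRank_Ft (t : Fin 4 → ℝ) {ν : Fin 8} (hν : ν = 1 ∨ ν = 2 ∨ ν = 5 ∨ ν = 6) :
    IsSingularPointOfRank (Ft t) (phi ν ⟨(0, 0), zero_mem_chartDomain ν⟩) 0 :=
  isSingularPointOfRank_phi_zero ν (contDiff_liftedFt t) (Ft_proj t) (liftedFt_signFlip t hν)

/-! ### The corners in coordinates -/

lemma mk_congr {z z' : Fin 8 → ℂ} {hz : momentum z = 0} {hz' : momentum z' = 0} (h : z = z') :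
    mk z hz = mk z' hz' := by
  subst h; rfl

lemma sqrt_eight : √8 = 2 * √2 := by
  rw [show (8 : ℝ) = 2 ^ 2 * 2 by norm_num, Real.sqrt_mul (by norm_num),
    Real.sqrt_sq (by norm_num)]

lemma sqrt_four : √4 = 2 := by
  rw [show (4 : ℝ) = 2 ^ 2 by norm_num, Real.sqrt_sq (by norm_num)]

/-- The integer `|z_k|²` at the corner `φ_ν(0, 0)`. -/
def cornerSq (ν k : Fin 8) : ℤ :=
  det k (ν + 1) * (0 - offset ν) + det ν k * (0 - offset (ν + 1)) + offset k

lemma chartRep_zero (ν k : Fin 8) : chartRep ν (0, 0) k = (√(cornerSq ν k : ℝ) : ℝ) := by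
  by_cases h1 : k = ν
  · simp [chartRep, cornerSq, h1, det_succ, det_self]
  by_cases h2 : k = ν + 1
  · simp [chartRep, cornerSq, h2, det_succ, det_self]
  · simp [chartRep, cornerSq, chartSq, h1, h2]

lemma phi_one_zero : phi 1 ⟨(0, 0), zero_mem_chartDomain 1⟩ = point2 := by
  have h : cornerSq 1 = ![2, 0, 0, 2, 4, 8, 6, 6] := by decide
  refine mk_congr (funext fun k => ?_)
  rw [chartRep_zero, h]
  fin_cases k <;> simp [sqrt_eight, sqrt_four]

lemma phi_two_zero : phi 2 ⟨(0, 0), zero_mem_chartDomain 2⟩ = point3 := by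
  have h : cornerSq 2 = ![4, 2, 0, 0, 2, 6, 6, 8] := by decide
  refine mk_congr (funext fun k => ?_)
  rw [chartRep_zero, h]
  fin_cases k <;> simp [sqrt_eight, sqrt_four]

lemma phi_five_zero : phi 5 ⟨(0, 0), zero_mem_chartDomain 5⟩ = point6 := by
  have h : cornerSq 5 = ![4, 8, 6, 6, 2, 0, 0, 2] := by decide
  refine mk_congr (funext fun k => ?_)
  rw [chartRep_zero, h]
  fin_cases k <;> simp [sqrt_eight, sqrt_four]

lemma phi_six_zero : phi 6 ⟨(0, 0), zero_mem_chartDomain 6⟩ = point7 := by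
  have h : cornerSq 6 = ![2, 6, 6, 8, 4, 2, 0, 0] := by decide
  refine mk_congr (funext fun k => ?_)
  rw [chartRep_zero, h]
  fin_cases k <;> simp [sqrt_eight, sqrt_four]

lemma J_mk (z : Fin 8 → ℂ) (hz : momentum z = 0) : J (mk z hz) = ‖z 0‖ ^ 2 / 2 := rfl

end Octagon

theorem mainTheorem2 (t : Fin 4 → ℝ) :
    (Octagon.phi 1 ⟨(0, 0), Octagon.zero_mem_chartDomain 1⟩ = Octagon.point2 ∧
      Octagon.phi 2 ⟨(0, 0), Octagon.zero_mem_chartDomain 2⟩ = Octagon.point3 ∧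
      Octagon.phi 5 ⟨(0, 0), Octagon.zero_mem_chartDomain 5⟩ = Octagon.point6 ∧
      Octagon.phi 6 ⟨(0, 0), Octagon.zero_mem_chartDomain 6⟩ = Octagon.point7) ∧
    (Octagon.IsSingularPointOfRank (Octagon.Ft t) Octagon.point2 0 ∧
      Octagon.IsSingularPointOfRank (Octagon.Ft t) Octagon.point3 0 ∧
      Octagon.IsSingularPointOfRank (Octagon.Ft t) Octagon.point6 0 ∧
      Octagon.IsSingularPointOfRank (Octagon.Ft t) Octagon.point7 0) ∧
    (Octagon.J Octagon.point2 = 1 ∧ Octagon.J Octagon.point7 = 1) ∧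
    (Octagon.J Octagon.point6 = 2 ∧ Octagon.J Octagon.point3 = 2) := by
  refine ⟨⟨Octagon.phi_one_zero, Octagon.phi_two_zero, Octagon.phi_five_zero,
    Octagon.phi_six_zero⟩, ⟨?_, ?_, ?_, ?_⟩, ⟨?_, ?_⟩, ⟨?_, ?_⟩⟩
  · exact Octagon.phi_one_zero ▸ Octagon.isSingularPointOfRank_Ft t (by simp)
  · exact Octagon.phi_two_zero ▸ Octagon.isSingularPointOfRank_Ft t (by simp)
  · exact Octagon.phi_five_zero ▸ Octagon.isSingularPointOfRank_Ft t (by simp)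
  · exact Octagon.phi_six_zero ▸ Octagon.isSingularPointOfRank_Ft t (by simp)
  · rw [Octagon.point2, Octagon.J_mk]; simp
  · rw [Octagon.point7, Octagon.J_mk]; simp
  · rw [Octagon.point6, Octagon.J_mk]; norm_num
  · rw [Octagon.point3, Octagon.J_mk]; norm_num
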